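/- Let $R$ be a $3$-dimensional (Noetherian) Cohen-Macaulay local ring, let $x,y,z$ be a system of parameters for $R$, and let $\alpha,\beta,\gamma,\alpha',\beta',\gamma'$ be positive integers. Let $I$ be the ideal of $R$ generated by the maximal minors of the matrix \[ \begin{pmatrix} x^{\alpha} & y^{\beta} & z^{\gamma}\\ y^{\beta'} & z^{\gamma'} & x^{\alpha'}\end{pmatrix}, \] and let $Q=(x^{\alpha''},y^{\beta''},z^{\gamma''})R$, where $\alpha''=\min\{\alpha,\alpha'\}$, $\beta''=\min\{\beta,\beta'\}$ and $\gamma''=\min\{\gamma,\gamma'\}$. Assume that $\alpha=1$, $\alpha'=2$, $2\beta\le\beta'$ and $2\gamma\le\gamma'$. Then $I^3:_R Q\subseteq I^3:_R Q^2$, and there is an isomorphism of $R$-modules \[ (I^3:_R Q^2)/(I^3:_R Q)\;\cong\;(R/Q)^{\oplus 3}. \] -/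

import Mathlib

/-- The depth of a local ring `R`: the supremum of the lengths of the `R`-regular sequences
contained in the maximal ideal. -/
noncomputable def localRingDepth (R : Type*) [CommRing R] [IsLocalRing R] : ℕ∞ :=
  ⨆ rs : {rs : List R // RingTheory.Sequence.IsRegular R rs ∧
    ∀ r ∈ rs, r ∈ IsLocalRing.maximalIdeal R}, (rs.1.length : ℕ∞)

/-- A Cohen-Macaulay local ring: a Noetherian local ring whose depth equals its Krull
dimension. -/
class IsCohenMacaulayLocalRing (R : Type*) [CommRing R] : Prop extends
    IsLocalRing R, IsNoetherianRing R where
  depth_eq_ringKrullDim : (localRingDepth R : WithBot ℕ∞) = ringKrullDim R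

/-- `s` is a system of parameters of the (Noetherian) local ring `R`: it has exactly `dim R`
members and generates an ideal primary to the maximal ideal, i.e. one whose radical is the maximal
ideal. -/
def IsSystemOfParameters {R : Type*} [CommRing R] [IsLocalRing R] {d : ℕ} (s : Fin d → R) : Prop :=
  ringKrullDim R = d ∧ (Ideal.span (Set.range s)).radical = IsLocalRing.maximalIdeal R

/-- The ideal generated by the maximal minors of an `m × n` matrix (`m ≤ n`), i.e. by the
determinants of the `m × m` submatrices obtained by choosing `m` columns. -/
def maximalMinorsIdeal {R : Type*} [CommRing R] {m n : ℕ} (M : Matrix (Fin m) (Fin n) R) :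
    Ideal R :=
  Ideal.span (Set.range fun e : Fin m ↪o Fin n => (M.submatrix id e).det)

/-! ### Systems of parameters of a Cohen-Macaulay local ring are regular sequences. -/

section

open RingTheory.Sequence IsLocalRing CategoryTheory Abelian Pointwise

/-! Put Y = y^β, Z = z^γ, p = y^(β'-2β), q = z^(γ'-2γ). The matrix becomes (x Y Z; pY² qZ² x²), and
Q is generated by the entries of r = (x, Y, Z). Let f be the vector of signed minors and l₁, l₂ the
linear forms in X₀, X₁, X₂ whose coefficients are the two rows. Since parameters form a regular
sequence, l₁ and l₂ generate all homogeneous relations on f (`exists_eq_of_eval_eq_zero`), and the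
relations between l₁ and l₂ are the trivial ones (`exists_eq_of_add_eq_zero`).

The hypotheses on exponents let l₂ be written r·w with w = (xX₂, pYX₀, qZX₁). At f both X and w
become orthogonal to r, so their cross product is δr for some δ, and Qδ ⊆ I². Exactness of the
Koszul complex of r gives I³ : Q = I³ + δI (`exists_eq_eval_linForm_mul_add`). For a linear form L,
L(f)δ lies in I³ exactly when the coefficients of L lie in Q (`mem_span_of_eval_linForm_mul_eq`).

Now I³ : Q² = (I³ : Q) : Q. For g in it write rᵢg ≡ Lᵢ(f)δ modulo I³. The 3 × 3 matrix of
coefficients of the Lᵢ is alternating modulo Q (`alternating_of_eq_eval_linForm_mul_add`), hence is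
given by a vector c modulo Q. Every c occurs (`exists_mul_sub_mem`), and g lies in I³ : Q exactly
when c vanishes modulo Q. This identifies the quotient with (R/Q)³. -/

theorem IsAssociatedPrime.exists_quotSMulTop {R M : Type*} [CommRing R] [IsNoetherianRing R]
    [IsLocalRing R] [AddCommGroup M] [Module R M] [Module.Finite R M] {P : Ideal R}
    (hP : IsAssociatedPrime P M) {a : R} (ha : IsSMulRegular M a) (ham : a ∈ maximalIdeal R) :
    ∃ Q : Ideal R, IsAssociatedPrime Q (QuotSMulTop a M) ∧ P ≤ Q ∧ a ∈ Q := by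
  obtain ⟨hprime, v, hv⟩ := isAssociatedPrime_iff.1 hP
  let N : Submodule R M := Submodule.torsionBySet R M P
  have hN : ¬ N ≤ a • (⊤ : Submodule R M) := by
    intro hle
    -- `N` consists of the elements killed by `P`. If `a * m` is killed by `P`, so is `m`, because
    -- `a` is regular; Nakayama then gives `N = 0`, although `v` is a nonzero element of `N`.
    have hsub : N ≤ (Ideal.span {a}) • N := by
      intro n hn
      obtain ⟨m, -, rfl⟩ := hle hn
      rw [Submodule.ideal_span_singleton_smul]
      refine Submodule.smul_mem_pointwise_smul _ _ _ ?_
      simp only [N, Submodule.mem_torsionBySet_iff] at hn ⊢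
      intro r
      apply ha
      have := hn r
      simp only [DistribSMul.toLinearMap_apply, smul_zero] at this ⊢
      rw [← this, smul_comm]
    have hbot : N = ⊥ := Submodule.eq_bot_of_le_smul_of_le_jacobson_bot (Ideal.span {a}) N
      (IsNoetherian.noetherian N) hsub (by
        rw [IsLocalRing.jacobson_eq_maximalIdeal _ bot_ne_top]
        simpa [Ideal.span_le] using ham)
    have hvN : v ∈ N := by
      simp only [N, Submodule.mem_torsionBySet_iff]
      rintro ⟨r, hr⟩
      have : r ∈ P := hr
      rw [hv, Submodule.mem_colon_singleton] at this
      simpa using this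
    rw [hbot, Submodule.mem_bot] at hvN
    apply hprime.ne_top
    rw [hv, hvN, Ideal.eq_top_iff_one, Submodule.mem_colon_singleton]
    simp
  obtain ⟨w, hwN, hw⟩ := SetLike.not_le_iff_exists.1 hN
  have hw0 : (Submodule.Quotient.mk w : QuotSMulTop a M) ≠ 0 := by
    rwa [Ne, Submodule.Quotient.mk_eq_zero]
  obtain ⟨Q, hQ, hle⟩ := exists_le_isAssociatedPrime_of_isNoetherianRing R _ hw0
  refine ⟨Q, hQ, fun r hr => hle ?_, hle ?_⟩
  · rw [Submodule.mem_colon_singleton, ← Submodule.Quotient.mk_smul]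
    have : r • w = 0 := (Submodule.mem_torsionBySet_iff _ _).1 hwN ⟨r, hr⟩
    simp [this]
  · rw [Submodule.mem_colon_singleton, ← Submodule.Quotient.mk_smul, Submodule.mem_bot,
      Submodule.Quotient.mk_eq_zero]
    exact Submodule.smul_mem_pointwise_smul _ _ _ trivial

theorem IsSMulRegular.notMem_of_isAssociatedPrime {R M : Type*} [CommRing R] [IsNoetherianRing R]
    [AddCommGroup M] [Module R M] {P : Ideal R} (hP : IsAssociatedPrime P M) {a : R}
    (ha : IsSMulRegular M a) : a ∉ P := by
  intro h
  have h1 : a ∈ ⋃ p ∈ associatedPrimes R M, (p : Set R) := Set.mem_biUnion hP h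
  rw [biUnion_associatedPrimes_eq_compl_regular] at h1
  exact h1 ha

/-- Dividing by a regular element `a` replaces `P` by an associated prime containing `P` and `a`. As
`a ∉ P`, the dimension drops by at least one each time. -/
theorem IsAssociatedPrime.length_le_ringKrullDim {R : Type*} [CommRing R]
    [IsNoetherianRing R] [IsLocalRing R] (rs : List R) {M : Type*} [AddCommGroup M] [Module R M]
    [Module.Finite R M] {P : Ideal R} (hP : IsAssociatedPrime P M) (hrs : IsWeaklyRegular M rs)
    (hm : ∀ r ∈ rs, r ∈ maximalIdeal R) : (rs.length : WithBot ℕ∞) ≤ ringKrullDim (R ⧸ P) := by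
  induction rs generalizing M P with
  | nil =>
    have := hP.isPrime
    simpa using ringKrullDim_nonneg_of_nontrivial
  | cons a rs ih =>
    rw [isWeaklyRegular_cons_iff] at hrs
    obtain ⟨Q, hQ, hPQ, haQ⟩ := hP.exists_quotSMulTop hrs.1 (hm a (by simp))
    have := hP.isPrime
    have h1 := ih hQ hrs.2 (fun r hr => hm r (by simp [hr]))
    have haP : Ideal.Quotient.mk P a ∈ nonZeroDivisors (R ⧸ P) := by
      rw [mem_nonZeroDivisors_iff_ne_zero, Ne, Ideal.Quotient.eq_zero_iff_mem]
      exact hrs.1.notMem_of_isAssociatedPrime hP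
    have h2 := ringKrullDim_quotient_succ_le_of_nonZeroDivisor haP
    have h3 : ringKrullDim (R ⧸ Q) ≤ ringKrullDim ((R ⧸ P) ⧸ Ideal.span {Ideal.Quotient.mk P a}) := by
      refine ringKrullDim_le_of_surjective (Ideal.Quotient.lift _ (Ideal.Quotient.factor hPQ) ?_) ?_
      · intro r hr
        obtain ⟨c, rfl⟩ := Ideal.mem_span_singleton.1 hr
        rw [map_mul]
        have : Ideal.Quotient.factor hPQ (Ideal.Quotient.mk P a) = 0 := by
          simpa [Ideal.Quotient.eq_zero_iff_mem] using haQ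
        simp [this]
      · apply Ideal.Quotient.lift_surjective_of_surjective
        exact Ideal.Quotient.factor_surjective hPQ
    push_cast [List.length_cons]
    exact (add_le_add_left (h1.trans h3) 1).trans h2

/-- Krull's height theorem in `R ⧸ P`, whose maximal ideal is minimal over the images of `xs`. -/
theorem ringKrullDim_quotient_le_length {R : Type*} [CommRing R]
    [IsNoetherianRing R] [IsLocalRing R] {P : Ideal R} [P.IsPrime] (xs : List R)
    (hxs : ∀ x ∈ xs, x ∈ maximalIdeal R)
    (hm : maximalIdeal R ≤ (Ideal.ofList xs ⊔ P).radical) :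
    ringKrullDim (R ⧸ P) ≤ xs.length := by
  classical
  have : IsLocalRing (R ⧸ P) :=
    IsLocalRing.of_surjective' (Ideal.Quotient.mk P) Ideal.Quotient.mk_surjective
  rw [← IsLocalRing.maximalIdeal_height_eq_ringKrullDim]
  have hcomap : (maximalIdeal (R ⧸ P)).comap (Ideal.Quotient.mk P) = maximalIdeal R :=
    have := Ideal.comap_isMaximal_of_surjective (K := maximalIdeal (R ⧸ P)) (Ideal.Quotient.mk P)
      Ideal.Quotient.mk_surjective
    IsLocalRing.eq_maximalIdeal this
  have hmin : maximalIdeal (R ⧸ P) ∈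
      (Ideal.span ((xs.map (Ideal.Quotient.mk P)).toFinset : Set (R ⧸ P))).minimalPrimes := by
    refine ⟨⟨inferInstance, ?_⟩, ?_⟩
    · rw [Ideal.span_le]
      intro r hr
      simp only [List.coe_toFinset, List.mem_map, Set.mem_ofPred_eq] at hr
      obtain ⟨x, hx, rfl⟩ := hr
      have := hxs x hx
      rw [← hcomap] at this
      exact this
    · rintro q ⟨hq, hle⟩ -
      have h1 : maximalIdeal R ≤ q.comap (Ideal.Quotient.mk P) := by
        refine hm.trans ((Ideal.IsPrime.radical_le_iff inferInstance).2 (sup_le ?_ ?_))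
        · rw [Ideal.ofList, Ideal.span_le]
          intro x hx
          exact hle (Ideal.subset_span (by simpa using ⟨x, hx, rfl⟩))
        · intro r hr
          simp [Ideal.mem_comap, Ideal.Quotient.eq_zero_iff_mem.2 hr]
      intro r hr
      obtain ⟨r, rfl⟩ := Ideal.Quotient.mk_surjective r
      rw [← Ideal.mem_comap, hcomap] at hr
      exact h1 hr
  have h := Ideal.height_le_card_of_mem_minimalPrimes_span_finset hmin
  have h2 : (xs.map (Ideal.Quotient.mk P)).toFinset.card ≤ xs.length := by
    simpa using List.toFinset_card_le (xs.map (Ideal.Quotient.mk P))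
  exact_mod_cast h.trans (by exact_mod_cast h2)

universe u

/-- Depth drops by at most one modulo any regular element: use the Ext characterization of depth and
the long exact sequence of multiplication by `x`. -/
theorem exists_isRegular_quotSMulTop {R : Type u} [CommRing R] [IsNoetherianRing R]
    [IsLocalRing R] {M : Type u} [AddCommGroup M] [Module R M] [Module.Finite R M]
    {rs : List R} {n : ℕ} (hlen : rs.length = n + 1) (hrs : IsRegular M rs)
    (hm : ∀ r ∈ rs, r ∈ maximalIdeal R) {x : R} (hx : IsSMulRegular M x)
    (hxm : x ∈ maximalIdeal R) :
    ∃ rs' : List R, rs'.length = n ∧ (∀ r ∈ rs', r ∈ maximalIdeal R) ∧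
      IsRegular (QuotSMulTop x M) rs' := by
  have := hrs.nontrivial
  have smul_lt (L : Type u) [AddCommGroup L] [Module R L] [Module.Finite R L] [Nontrivial L] :
      maximalIdeal R • (⊤ : Submodule R L) < ⊤ :=
    (Submodule.top_ne_ideal_smul_of_le_jacobson_annihilator
      (IsLocalRing.maximalIdeal_le_jacobson _)).symm.lt_top
  have hQ : Nontrivial (QuotSMulTop x M) := nontrivial_quotSMulTop_of_mem_maximalIdeal M hxm
  have key := (ModuleCat.exists_isRegular_tfae (maximalIdeal R) (n + 1) (ModuleCat.of R M)
    (smul_lt M)).out 3 1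
  have key' := (ModuleCat.exists_isRegular_tfae (maximalIdeal R) n
    (ModuleCat.of R (QuotSMulTop x M)) (smul_lt _)).out 1 3
  have h_ext := key.1 ⟨rs, hlen, hm, hrs⟩
  refine key'.1 fun i hi => ?_
  have zero1 := AddCommGrpCat.isZero_of_iff_subsingleton.mpr (h_ext i (by omega))
  have zero2 := AddCommGrpCat.isZero_of_iff_subsingleton.mpr (h_ext (i + 1) (by omega))
  exact AddCommGrpCat.subsingleton_of_isZero <| ShortComplex.Exact.isZero_of_both_zeros
    ((Ext.covariant_sequence_exact₃' _
      (IsSMulRegular.smulShortComplex_shortExact (M := ModuleCat.of R M) hx)) i (i + 1) rfl)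
    (zero1.eq_zero_of_src _) (zero2.eq_zero_of_tgt _)

theorem isWeaklyRegular_of_le_radical {R : Type u} [CommRing R] [IsNoetherianRing R]
    [IsLocalRing R] (xs : List R) (hxs : ∀ x ∈ xs, x ∈ maximalIdeal R)
    {M : Type u} [AddCommGroup M] [Module R M] [Module.Finite R M]
    (hrad : maximalIdeal R ≤ (Ideal.ofList xs ⊔ Module.annihilator R M).radical)
    {rs : List R} (hlen : rs.length = xs.length) (hrs : IsRegular M rs)
    (hm : ∀ r ∈ rs, r ∈ maximalIdeal R) : IsWeaklyRegular M xs := by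
  induction xs generalizing M rs with
  | nil => exact IsWeaklyRegular.nil R M
  | cons x xs ih =>
    have hx : IsSMulRegular M x := by
      -- Otherwise `x` lies in an associated prime `P`. The dimension of `R ⧸ P` is at least
      -- `rs.length = xs.length + 1`, yet `xs` alone generates its maximal ideal up to radical.
      by_contra hx
      have h1 : x ∈ ⋃ p ∈ associatedPrimes R M, (p : Set R) := by
        rw [biUnion_associatedPrimes_eq_compl_regular]
        exact hx
      obtain ⟨P, hP, hxP⟩ := Set.mem_iUnion₂.1 h1
      have := IsAssociatedPrime.isPrime hP
      have h2 := IsAssociatedPrime.length_le_ringKrullDim rs hP hrs.toIsWeaklyRegular hm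
      have h3 : ringKrullDim (R ⧸ P) ≤ xs.length := by
        refine ringKrullDim_quotient_le_length xs (fun y hy => hxs y (by simp [hy]))
          (hrad.trans (Ideal.radical_mono (sup_le ?_ ?_)))
        · rw [Ideal.ofList_cons]
          exact sup_le (le_sup_of_le_right ((Ideal.span_singleton_le_iff_mem _).2 hxP)) le_sup_left
        · exact le_sup_of_le_right (Submodule.annihilator_top (R := R) (M := M) ▸ IsAssociatedPrime.annihilator_le hP)
      have h4 := h2.trans h3
      rw [hlen] at h4
      simp only [List.length_cons] at h4
      have : xs.length + 1 ≤ xs.length := by exact_mod_cast h4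
      omega
    rw [isWeaklyRegular_cons_iff]
    refine ⟨hx, ?_⟩
    have hxm := hxs x (by simp)
    obtain ⟨rs', hl, hm', hr'⟩ := exists_isRegular_quotSMulTop (n := xs.length)
      (by simpa using hlen) hrs hm hx hxm
    refine ih (fun y hy => hxs y (by simp [hy])) (hrad.trans (Ideal.radical_mono ?_)) hl hr' hm'
    rw [Ideal.ofList_cons]
    refine sup_le (sup_le ?_ le_sup_left) (le_sup_of_le_right ?_)
    · exact le_sup_of_le_right
        ((Ideal.span_singleton_le_iff_mem _).2 (QuotSMulTop.mem_annihilator M x))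
    · intro r hr
      rw [Module.mem_annihilator] at hr ⊢
      intro m
      obtain ⟨m, rfl⟩ := Submodule.Quotient.mk_surjective _ m
      rw [← Submodule.Quotient.mk_smul, hr, Submodule.Quotient.mk_zero]

theorem IsSystemOfParameters.isWeaklyRegular {R : Type u} [CommRing R] [IsCohenMacaulayLocalRing R]
    {d : ℕ} {s : Fin d → R} (hs : IsSystemOfParameters s) : IsWeaklyRegular R (List.ofFn s) := by
  obtain ⟨hdim, hrad⟩ := hs
  have hdepth : localRingDepth R = d := by
    have := IsCohenMacaulayLocalRing.depth_eq_ringKrullDim (R := R)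
    rw [hdim] at this
    exact_mod_cast this
  have hmem : ∀ x ∈ List.ofFn s, x ∈ maximalIdeal R := by
    intro x hx
    rw [List.mem_ofFn'] at hx
    rw [← hrad]
    exact Ideal.le_radical (Ideal.subset_span hx)
  obtain ⟨rs, hlen, hreg, hm⟩ : ∃ rs : List R, rs.length = d ∧ IsRegular R rs ∧
      ∀ r ∈ rs, r ∈ maximalIdeal R := by
    rcases d with _ | d
    · exact ⟨[], rfl, IsRegular.nil R R, by simp⟩
    have hlt : (d : ℕ∞) < localRingDepth R := by
      rw [hdepth]
      exact_mod_cast d.lt_succ_self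
    obtain ⟨⟨rs, hreg, hm⟩, hl⟩ := lt_iSup_iff.1 hlt
    have hl : d < rs.length := by exact_mod_cast hl
    refine ⟨rs.take (d + 1), by simp; omega, ?_, fun r hr => hm r (List.mem_of_mem_take hr)⟩
    refine IsRegular.of_isWeaklyRegular_of_mem_maximalIdeal R
      (fun r hr => hm r (List.mem_of_mem_take hr)) ?_
    have h := hreg.toIsWeaklyRegular
    rw [← List.take_append_drop (d + 1) rs, isWeaklyRegular_append_iff] at h
    exact h.1
  refine isWeaklyRegular_of_le_radical _ hmem ?_ (by simpa using hlen) hreg hm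
  rw [← hrad]
  refine Ideal.radical_mono (le_sup_of_le_left ?_)
  rw [Ideal.span_le]
  rintro _ ⟨i, rfl⟩
  exact Ideal.subset_span (by simp [List.mem_ofFn])

end

/-! ### Koszul exactness for regular triples, and multiplication by linear forms over a polynomial
ring. -/

section

open RingTheory.Sequence MvPolynomial

theorem isWeaklyRegular_triple_iff {S : Type*} [CommRing S] {a b c : S} :
    IsWeaklyRegular S [a, b, c] ↔ (∀ u, a * u = 0 → u = 0) ∧
      (∀ u v, b * u = a * v → ∃ w, u = a * w) ∧
      (∀ u v w, c * u = a * v + b * w → ∃ s t, u = a * s + b * t) := by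
  have key (I : Ideal S) (r : S) : IsSMulRegular (S ⧸ (I • (⊤ : Submodule S S))) r ↔
      ∀ u, r * u ∈ I → u ∈ I := by
    have : (I • (⊤ : Submodule S S)) = I := by simp
    rw [isSMulRegular_quotient_iff_mem_of_smul_mem, this]
    rfl
  have h3 : [a, b, c] = ([] ++ [a]) ++ [b] ++ [c] := rfl
  rw [h3, isWeaklyRegular_append_iff, isWeaklyRegular_append_iff, isWeaklyRegular_append_iff,
    isWeaklyRegular_singleton_iff, isWeaklyRegular_singleton_iff, isWeaklyRegular_singleton_iff,
    key, key, key]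
  simp only [IsWeaklyRegular.nil, true_and, Ideal.ofList_nil, List.nil_append, Ideal.mem_bot,
    Ideal.ofList_singleton, Ideal.ofList_append, ← Ideal.span_union, and_assoc,
    Set.singleton_union, Ideal.mem_span_singleton', Ideal.mem_span_pair]
  refine and_congr_right' (and_congr ⟨fun h u v huv => ?_, fun h u ⟨v, hv⟩ => ?_⟩
    ⟨fun h u v w huv => ?_, fun h u ⟨v, w, hv⟩ => ?_⟩)
  · obtain ⟨w, hw⟩ := h u ⟨v, by rw [huv, mul_comm]⟩
    exact ⟨w, by rw [← hw, mul_comm]⟩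
  · obtain ⟨w, hw⟩ := h u v (by rw [← hv, mul_comm])
    exact ⟨w, by rw [hw, mul_comm]⟩
  · obtain ⟨s, t, hw⟩ := h u ⟨v, w, by rw [huv]; ring⟩
    exact ⟨s, t, by rw [← hw]; ring⟩
  · obtain ⟨s, t, hw⟩ := h u v w (by rw [← hv]; ring)
    exact ⟨s, t, by rw [hw]; ring⟩

namespace RingTheory.Sequence.IsWeaklyRegular

variable {S : Type*} [CommRing S] {a b c : S}

/-- Koszul exactness: a vector parallel to `(a, b, c)` is a multiple of it. Two components of the
cross product suffice, as `a` is regular. -/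
theorem exists_eq_mul_of_cross_eq_zero (h : IsWeaklyRegular S [a, b, c]) {u v w : S}
    (h2 : c * u = a * w) (h3 : a * v = b * u) :
    ∃ g, u = a * g ∧ v = b * g ∧ w = c * g := by
  obtain ⟨r1, r2, r3⟩ := isWeaklyRegular_triple_iff.1 h
  obtain ⟨g, rfl⟩ := r2 u v h3.symm
  refine ⟨g, rfl, sub_eq_zero.1 (r1 _ ?_), sub_eq_zero.1 (r1 _ ?_)⟩
  · linear_combination h3
  · linear_combination -h2

/-- Koszul exactness one place further: a vector orthogonal to `(a, b, c)` is a cross product with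
it. -/
theorem exists_eq_cross_of_dot_eq_zero (h : IsWeaklyRegular S [a, b, c]) {u v w : S}
    (h1 : a * u + b * v + c * w = 0) :
    ∃ d e f, u = b * f - c * e ∧ v = c * d - a * f ∧ w = a * e - b * d := by
  obtain ⟨r1, r2, r3⟩ := isWeaklyRegular_triple_iff.1 h
  obtain ⟨e, d, rfl⟩ := r3 w (-u) (-v) (by linear_combination h1)
  obtain ⟨f, hf⟩ := r2 (v + c * d) (-(u + c * e)) (by linear_combination h1)
  refine ⟨-d, e, -f, ?_, ?_, by ring⟩
  · refine sub_eq_zero.1 (r1 _ ?_)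
    linear_combination h1 - b * hf
  · linear_combination hf

theorem map_C {σ R : Type*} [CommRing R] {rs : List R} (h : IsWeaklyRegular R rs) :
    IsWeaklyRegular (MvPolynomial σ R) (rs.map (C : R →+* MvPolynomial σ R)) :=
  h.of_flat (S := MvPolynomial σ R)

theorem pow_triple [IsNoetherianRing S] [IsLocalRing S] (h : IsWeaklyRegular S [a, b, c])
    (ha : a ∈ IsLocalRing.maximalIdeal S) (hb : b ∈ IsLocalRing.maximalIdeal S)
    (hc : c ∈ IsLocalRing.maximalIdeal S) {m n : ℕ} (hm : 0 < m) (hn : 0 < n) :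
    IsWeaklyRegular S [a, b ^ m, c ^ n] := by
  have key : ∀ {a b c : S}, IsWeaklyRegular S [a, b, c] → ∀ n, IsWeaklyRegular S [a, b, c ^ n] := by
    intro a b c h n
    change IsWeaklyRegular S ([a, b] ++ [c]) at h
    change IsWeaklyRegular S ([a, b] ++ [c ^ n])
    rw [isWeaklyRegular_append_iff, isWeaklyRegular_singleton_iff] at h ⊢
    exact ⟨h.1, h.2.pow n⟩
  have hc' := Ideal.pow_mem_of_mem _ hc n hn
  have hb' := Ideal.pow_mem_of_mem _ hb m hm
  have h1 := IsLocalRing.isWeaklyRegular_of_perm_of_subset_maximalIdeal (key h n)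
    (rs' := [a, c ^ n, b]) (by simpa using List.Perm.swap _ _ _) (by simp only [List.mem_cons, List.not_mem_nil, or_false, forall_eq_or_imp, forall_eq]; exact ⟨ha, hb, hc'⟩)
  exact IsLocalRing.isWeaklyRegular_of_perm_of_subset_maximalIdeal (key h1 m)
    (by simpa using List.Perm.swap _ _ _) (by simp only [List.mem_cons, List.not_mem_nil, or_false, forall_eq_or_imp, forall_eq]; exact ⟨ha, hc', hb'⟩)

end RingTheory.Sequence.IsWeaklyRegular

namespace MvPolynomial

variable {σ R : Type*} [CommRing R]

theorem mem_map_C_of_linear_mul_mem {J : Ideal R} [Fintype σ] (a : σ → R) (i : σ)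
    (hi : ∀ u, a i * u ∈ J → u ∈ J) {A : MvPolynomial σ R}
    (h : (∑ j, C (a j) * X j) * A ∈ J.map C) : A ∈ J.map C := by
  classical
  rw [mem_map_C_iff] at h ⊢
  by_contra! hne
  let s := A.support.filter fun e => A.coeff e ∉ J
  have hs : s.Nonempty := by
    obtain ⟨e, he⟩ := hne
    refine ⟨e, Finset.mem_filter.2 ⟨mem_support_iff.2 fun h0 => he ?_, he⟩⟩
    rw [h0]
    exact J.zero_mem
  -- Among the monomials with coefficient outside `J`, take one of largest degree in `X i`. In the
  -- coefficient of the product at `e + single i 1`, the terms with `j ≠ i` come from monomials of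
  -- larger degree in `X i`, hence lie in `J`.
  obtain ⟨e, hes, hmax⟩ := s.exists_max_image (fun e => e i) hs
  have heJ := (Finset.mem_filter.1 hes).2
  refine heJ (hi _ ?_)
  have h1 := h (e + Finsupp.single i 1)
  rw [Finset.sum_mul, coeff_sum, ← Finset.add_sum_erase _ _ (Finset.mem_univ i), mul_assoc,
    coeff_C_mul, mul_comm (X i), coeff_mul_X] at h1
  refine (J.add_mem_iff_left (J.sum_mem fun j hj => ?_)).1 h1
  rw [mul_assoc, coeff_C_mul, mul_comm (X j), coeff_mul_X']
  refine J.mul_mem_left _ ?_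
  split_ifs
  · by_contra hJ
    have := hmax (e + Finsupp.single i 1 - Finsupp.single j 1) (Finset.mem_filter.2
      ⟨mem_support_iff.2 fun h0 => hJ (h0 ▸ J.zero_mem), hJ⟩)
    simp [(Finset.mem_erase.1 hj).1] at this
  · exact J.zero_mem

theorem aeval_sub_aeval_mem {A : Type*} [CommRing A] [Algebra R A] {I : Ideal A} {u v : σ → A}
    (h : ∀ i, u i - v i ∈ I) (P : MvPolynomial σ R) : aeval u P - aeval v P ∈ I := by
  have : (Ideal.Quotient.mkₐ R I).comp (aeval u) = (Ideal.Quotient.mkₐ R I).comp (aeval v) := by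
    refine algHom_ext fun i => ?_
    simpa using Ideal.Quotient.eq.2 (h i)
  exact Ideal.Quotient.eq.1 (DFunLike.congr_fun this P)

theorem IsHomogeneous.aeval_const_mul {A : Type*} [CommRing A] [Algebra R A] {P : MvPolynomial σ R}
    {d : ℕ} (hP : P.IsHomogeneous d) (c : A) (u : σ → A) :
    MvPolynomial.aeval (fun i => c * u i) P = c ^ d * MvPolynomial.aeval u P := by
  rw [aeval_def, aeval_def, eval₂_eq, eval₂_eq, Finset.mul_sum]
  refine Finset.sum_congr rfl fun e he => ?_
  rw [← hP (mem_support_iff.1 he)]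
  simp_rw [mul_pow, Finset.prod_mul_distrib, Finset.prod_pow_eq_pow_sum]
  rw [show Finsupp.weight 1 e = ∑ i ∈ e.support, e i by
    simp [Finsupp.weight_apply, Finsupp.sum]]
  ring

theorem homogeneousComponent_mul_of_isHomogeneous {P A : MvPolynomial σ R} {d : ℕ}
    (hP : P.IsHomogeneous d) (n : ℕ) :
    homogeneousComponent (d + n) (P * A) = P * homogeneousComponent n A := by
  classical
  conv_lhs => rw [← sum_homogeneousComponent A, Finset.mul_sum, map_sum]
  have h (k : ℕ) : homogeneousComponent (d + n) (P * homogeneousComponent k A) =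
      if k = n then P * homogeneousComponent k A else 0 := by
    rw [homogeneousComponent_of_mem (hP.mul (homogeneousComponent_isHomogeneous k A))]
    simp [eq_comm]
  simp_rw [h]
  rw [Finset.sum_ite_eq']
  split_ifs with hn
  · rfl
  · rw [homogeneousComponent_eq_zero _ _ (by simpa using hn), mul_zero]

end MvPolynomial

namespace MvPolynomial

variable {σ R : Type*} [CommRing R]

theorem mem_map_C_span_singleton {d : R} {A : MvPolynomial σ R} :
    A ∈ (Ideal.span {d}).map C ↔ ∃ D, A = C d * D := by
  rw [Ideal.map_span, Set.image_singleton, Ideal.mem_span_singleton]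
  rfl

theorem mem_map_C_span_pair {d e : R} {A : MvPolynomial σ R} :
    A ∈ (Ideal.span {d, e}).map C ↔ ∃ D E, A = C d * D + C e * E := by
  rw [Ideal.map_span, Set.image_pair, Ideal.mem_span_pair]
  simp only [mul_comm, eq_comm]

theorem exists_eq_C_mul_of_C_mul_eq {r d : R} (h : ∀ u v, r * u = d * v → ∃ w, u = d * w)
    {A B : MvPolynomial σ R} (hAB : C r * A = C d * B) : ∃ D, A = C d * D := by
  rw [← mem_map_C_span_singleton, mem_map_C_iff]
  intro m
  have := congrArg (coeff m) hAB
  rw [coeff_C_mul, coeff_C_mul] at this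
  exact Ideal.mem_span_singleton.2 (h _ _ this)

theorem eq_zero_of_C_mul_eq_zero {r : R} (h : ∀ u, r * u = 0 → u = 0)
    {A : MvPolynomial σ R} (hA : C r * A = 0) : A = 0 := by
  obtain ⟨D, hD⟩ := exists_eq_C_mul_of_C_mul_eq (r := r) (d := 0) (A := A) (B := 0)
    (fun u v huv => ⟨0, by simpa using h u (by simpa using huv)⟩) (by simpa using hA)
  simpa using hD

/-- The linear form with coefficient vector `a`. -/
noncomputable def linForm [Fintype σ] (a : σ → R) : MvPolynomial σ R := ∑ j, C (a j) * X j

theorem linForm_isHomogeneous [Fintype σ] (a : σ → R) : (linForm a).IsHomogeneous 1 :=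
  IsHomogeneous.sum _ _ _ fun j _ => isHomogeneous_C_mul_X _ j

theorem linForm_vec3 (a b c : R) :
    linForm ![a, b, c] = C a * X 0 + C b * X 1 + C c * X 2 := by
  simp [linForm, Fin.sum_univ_three]

section

variable [Fintype σ] {a : σ → R} (i : σ) {d e : R} {A B B' : MvPolynomial σ R}
include i

theorem exists_eq_C_mul_of_linForm_mul_eq (hi : ∀ u v, a i * u = d * v → ∃ w, u = d * w)
    (h : linForm a * A = C d * B) : ∃ D, A = C d * D := by
  rw [← mem_map_C_span_singleton]
  refine mem_map_C_of_linear_mul_mem a i (fun u hu => ?_) (mem_map_C_span_singleton.2 ⟨B, h⟩)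
  obtain ⟨v, hv⟩ := Ideal.mem_span_singleton.1 hu
  exact Ideal.mem_span_singleton.2 (hi u v hv)

theorem exists_eq_C_mul_add_of_linForm_mul_eq
    (hi : ∀ u v w, a i * u = d * v + e * w → ∃ s t, u = d * s + e * t)
    (h : linForm a * A = C d * B + C e * B') : ∃ D E, A = C d * D + C e * E := by
  rw [← mem_map_C_span_pair]
  refine mem_map_C_of_linear_mul_mem a i (fun u hu => ?_) (mem_map_C_span_pair.2 ⟨B, B', h⟩)
  rw [Ideal.mem_span_pair] at hu ⊢
  obtain ⟨v, w, hv⟩ := hu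
  obtain ⟨s, t, rfl⟩ := hi u v w (by rw [← hv]; ring)
  exact ⟨s, t, by ring⟩

theorem eq_zero_of_linForm_mul_eq_zero (hi : ∀ u, a i * u = 0 → u = 0)
    (h : linForm a * A = 0) : A = 0 := by
  obtain ⟨D, hD⟩ := exists_eq_C_mul_of_linForm_mul_eq (a := a) (d := 0) (A := A) (B := 0) i
    (fun u v huv => ⟨0, by simpa using hi u (by simpa using huv)⟩) (by simpa using h)
  simpa using hD

end

end MvPolynomial

/-! ### Relations among the minors. -/

/-- The signed maximal minors of the matrix `(x Y Z; p * Y ^ 2, q * Z ^ 2, x ^ 2)`. -/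
def signedMinors {R : Type*} [CommRing R] (x Y Z p q : R) : Fin 3 → R :=
  ![Y * x ^ 2 - q * Z ^ 3, p * Y ^ 2 * Z - x ^ 3, q * x * Z ^ 2 - p * Y ^ 3]

/-- The regularity conditions on the entries of `(x Y Z; p * Y ^ 2, q * Z ^ 2, x ^ 2)` and on two
of its maximal minors under which the powers of the ideal of maximal minors are resolved by the
symmetric algebra. -/
structure RegularMinors {R : Type*} [CommRing R] (x Y Z p q : R) : Prop where
  row : IsWeaklyRegular R [x, Y, Z]
  snd_regular : ∀ u, Y * u = 0 → u = 0
  fst_regular_mod_snd : ∀ u v, x * u = Y * v → ∃ w, u = Y * w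
  minor_regular : ∀ u, (Y * x ^ 2 - q * Z ^ 3) * u = 0 → u = 0
  snd_regular_mod_minor : ∀ u v, Y * u = (Y * x ^ 2 - q * Z ^ 3) * v →
    ∃ w, u = (Y * x ^ 2 - q * Z ^ 3) * w
  minor_regular_mod_minor : ∀ u v, (q * x * Z ^ 2 - p * Y ^ 3) * u = (Y * x ^ 2 - q * Z ^ 3) * v →
    ∃ w, u = (Y * x ^ 2 - q * Z ^ 3) * w
  fst_regular_mod_minors : ∀ u v w,
    x * u = (Y * x ^ 2 - q * Z ^ 3) * v + (q * x * Z ^ 2 - p * Y ^ 3) * w →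
      ∃ s t, u = (Y * x ^ 2 - q * Z ^ 3) * s + (q * x * Z ^ 2 - p * Y ^ 3) * t

namespace RegularMinors

variable {R : Type*} [CommRing R] {x Y Z p q : R}

/-- The third minor times `X 0` is regular modulo `l₁` and the first minor; `l₂` enters only through
this product. -/
theorem exists_eq_of_C_mul_X_mul_eq (H : RegularMinors x Y Z p q)
    {A W V : MvPolynomial (Fin 3) R}
    (h : C (q * x * Z ^ 2 - p * Y ^ 3) * (X 0 * A) =
      linForm ![x, Y, Z] * W + C (Y * x ^ 2 - q * Z ^ 3) * V) :
    ∃ W' V', A = linForm ![x, Y, Z] * W' + C (Y * x ^ 2 - q * Z ^ 3) * V' := by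
  have hmod := H.fst_regular_mod_minors
  have h31 := H.minor_regular_mod_minor
  have hY := H.snd_regular_mod_minor
  generalize Y * x ^ 2 - q * Z ^ 3 = f at *
  generalize q * x * Z ^ 2 - p * Y ^ 3 = g at *
  obtain ⟨W2, W1, rfl⟩ := exists_eq_C_mul_add_of_linForm_mul_eq (a := ![x, Y, Z]) (d := f)
    (e := g) (A := W) (B := -V) (B' := X 0 * A) 0 (by simpa using hmod) (by linear_combination -h)
  obtain ⟨V1, hV1⟩ := exists_eq_C_mul_of_C_mul_eq (r := g) (d := f)
    (A := X 0 * A - linForm ![x, Y, Z] * W1) (B := V + linForm ![x, Y, Z] * W2) h31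
    (by linear_combination h)
  -- Setting `X 0 = 0` shows that `W1` is a multiple of `X 0` modulo `f`, after which `X 0` can be
  -- cancelled.
  let φ : MvPolynomial (Fin 3) R →ₐ[R] MvPolynomial (Fin 3) R := aeval ![0, X 1, X 2]
  have hφl : φ (linForm ![x, Y, Z]) = linForm ![0, Y, Z] := by
    simp [φ, linForm_vec3, algebraMap_eq]
  have hφC (r : R) : φ (C r) = C r := φ.commutes r
  have hφ := congrArg φ hV1
  rw [map_sub, map_mul, map_mul, map_mul, hφl, hφC, show φ (X 0) = 0 by simp [φ]] at hφ
  obtain ⟨V2, hV2⟩ := exists_eq_C_mul_of_linForm_mul_eq (a := ![0, Y, Z]) (d := f)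
    (A := φ W1) (B := - φ V1) 1 (by simpa using hY) (by linear_combination -hφ)
  have hW : aeval X W1 - φ W1 ∈ Ideal.span {X 0} := by
    refine aeval_sub_aeval_mem (fun i => ?_) W1
    rw [Ideal.mem_span_singleton]
    fin_cases i <;> simp
  rw [aeval_X_left_apply, Ideal.mem_span_singleton] at hW
  obtain ⟨W3, hW3⟩ := hW
  have hX : linForm ![1, 0, 0] = (X 0 : MvPolynomial (Fin 3) R) := by simp [linForm_vec3]
  obtain ⟨V3, hV3⟩ := exists_eq_C_mul_of_linForm_mul_eq (a := ![1, 0, 0]) (d := f)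
    (A := A - linForm ![x, Y, Z] * W3) (B := V1 + linForm ![x, Y, Z] * V2) 0
    (fun u v huv => ⟨v, by simpa using huv⟩)
    (by rw [hX]; linear_combination hV1 + linForm ![x, Y, Z] * hW3 + linForm ![x, Y, Z] * hV2)
  exact ⟨W3, V3, by linear_combination hV3⟩

/-- The first minor is regular modulo `(l₁, l₂)`. By `hid`, `Y * l₂` is, modulo `l₁` and that minor,
minus the third minor times `X 0`, so the preceding lemma controls `D`. -/
theorem exists_eq_of_C_mul_eq (H : RegularMinors x Y Z p q) {A B D : MvPolynomial (Fin 3) R}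
    (h : C (Y * x ^ 2 - q * Z ^ 3) * A =
      linForm ![x, Y, Z] * B + linForm ![p * Y ^ 2, q * Z ^ 2, x ^ 2] * D) :
    ∃ B' D', A = linForm ![x, Y, Z] * B' + linForm ![p * Y ^ 2, q * Z ^ 2, x ^ 2] * D' := by
  have hid : C Y * linForm ![p * Y ^ 2, q * Z ^ 2, x ^ 2] = C (q * Z ^ 2) * linForm ![x, Y, Z] +
      C (Y * x ^ 2 - q * Z ^ 3) * X 2 - C (q * x * Z ^ 2 - p * Y ^ 3) * X 0 := by
    simp only [linForm_vec3, map_sub, map_mul, map_pow]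
    ring
  obtain ⟨W, V, rfl⟩ := H.exists_eq_of_C_mul_X_mul_eq (A := D)
    (W := C Y * B + C (q * Z ^ 2) * D) (V := X 2 * D - C Y * A)
    (by linear_combination C Y * h + D * hid)
  obtain ⟨B', hB'⟩ := exists_eq_C_mul_of_linForm_mul_eq (a := ![x, Y, Z])
    (d := Y * x ^ 2 - q * Z ^ 3) (A := B + linForm ![p * Y ^ 2, q * Z ^ 2, x ^ 2] * W)
    (B := A - linForm ![p * Y ^ 2, q * Z ^ 2, x ^ 2] * V) 1
    (by simpa using H.snd_regular_mod_minor) (by linear_combination -h)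
  refine ⟨B', V, sub_eq_zero.1 (eq_zero_of_C_mul_eq_zero H.minor_regular ?_)⟩
  linear_combination h + linForm ![x, Y, Z] * hB'

/-- Homogeneous relations among the maximal minors are generated by the linear ones coming from
the rows of the matrix. -/
theorem exists_eq_of_eval_eq_zero (H : RegularMinors x Y Z p q) {A : MvPolynomial (Fin 3) R}
    {d : ℕ} (hA : A.IsHomogeneous d) (h : eval (signedMinors x Y Z p q) A = 0) :
    ∃ B D, A = linForm ![x, Y, Z] * B + linForm ![p * Y ^ 2, q * Z ^ 2, x ^ 2] * D := by
  let J : Ideal (MvPolynomial (Fin 3) R) :=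
    Ideal.span {linForm ![x, Y, Z], linForm ![p * Y ^ 2, q * Z ^ 2, x ^ 2]}
  have hJ (P : MvPolynomial (Fin 3) R) : P ∈ J ↔ ∃ B D,
      P = linForm ![x, Y, Z] * B + linForm ![p * Y ^ 2, q * Z ^ 2, x ^ 2] * D := by
    rw [Ideal.mem_span_pair]
    simp only [mul_comm, eq_comm]
  have hreg : ∀ n, C (Y * x ^ 2 - q * Z ^ 3) ^ n * A ∈ J → A ∈ J := by
    intro n
    induction n with
    | zero => simp
    | succ n ih =>
      intro hn
      rw [pow_succ', mul_assoc, hJ] at hn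
      obtain ⟨B, D, hBD⟩ := hn
      exact ih ((hJ _).2 (H.exists_eq_of_C_mul_eq hBD))
  rw [← hJ]
  refine hreg d ?_
  -- Modulo `J` the vectors `X` and `f` are proportional: `f₀ Xᵢ ≡ fᵢ X₀`. Homogeneity gives `f₀^d A
  -- ≡ X₀^d A(f) = 0`, and `f₀` is regular modulo `J`.
  have h1 : ∀ i, C (Y * x ^ 2 - q * Z ^ 3) * X i - X 0 * C (signedMinors x Y Z p q i) ∈ J := by
    intro i
    rw [hJ]
    fin_cases i
    · exact ⟨0, 0, by simp [signedMinors]; ring⟩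
    · refine ⟨C (x ^ 2), -C Z, ?_⟩
      simp [signedMinors, linForm_vec3]
      ring
    · refine ⟨-C (q * Z ^ 2), C Y, ?_⟩
      simp [signedMinors, linForm_vec3]
      ring
  have h2 := aeval_sub_aeval_mem h1 A
  rw [hA.aeval_const_mul, hA.aeval_const_mul, aeval_X_left_apply] at h2
  have h3 : aeval (fun i => (C (signedMinors x Y Z p q i) : MvPolynomial (Fin 3) R)) A =
      C (eval (signedMinors x Y Z p q) A) := by
    have : ((aeval fun i => (C (signedMinors x Y Z p q i) : MvPolynomial (Fin 3) R)) :
        MvPolynomial (Fin 3) R →ₐ[R] _) =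
        (Algebra.ofId R (MvPolynomial (Fin 3) R)).comp (aeval (signedMinors x Y Z p q)) := by
      refine algHom_ext fun i => ?_
      simp [Algebra.ofId_apply, algebraMap_eq]
    rw [this, AlgHom.comp_apply, Algebra.ofId_apply, algebraMap_eq]
    rfl
  rwa [h3, h, map_zero, mul_zero, sub_zero] at h2

/-- The two row relations form a regular sequence. -/
theorem exists_eq_of_add_eq_zero (H : RegularMinors x Y Z p q) {B D : MvPolynomial (Fin 3) R}
    (h : linForm ![x, Y, Z] * B + linForm ![p * Y ^ 2, q * Z ^ 2, x ^ 2] * D = 0) :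
    ∃ V, D = linForm ![x, Y, Z] * V ∧ B = -(linForm ![p * Y ^ 2, q * Z ^ 2, x ^ 2] * V) := by
  -- The combination of the two row forms from which `X 1` is eliminated.
  let s : MvPolynomial (Fin 3) R :=
    linForm ![-(q * x * Z ^ 2 - p * Y ^ 3), 0, Y * x ^ 2 - q * Z ^ 3]
  have hs : s = C Y * linForm ![p * Y ^ 2, q * Z ^ 2, x ^ 2] - C (q * Z ^ 2) * linForm ![x, Y, Z] := by
    simp only [s, linForm_vec3, map_sub, map_mul, map_pow, map_neg, map_zero]
    ring
  have hsD : s * D = linForm ![x, Y, Z] * -(C Y * B + C (q * Z ^ 2) * D) := by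
    rw [hs]
    linear_combination C Y * h
  have hhom : ∀ d (A W : MvPolynomial (Fin 3) R), A.IsHomogeneous d →
      s * A = linForm ![x, Y, Z] * W → ∃ V, A = linForm ![x, Y, Z] * V := by
    intro d A W hA hAW
    -- Solves `l₁ = 0` for `X 1`, with denominators cleared by `Y`. Thus `ρ` kills `l₁`, and `Y^d A
    -- ≡ ρ A` modulo `l₁` for `A` homogeneous of degree `d`.
    let ρ : MvPolynomial (Fin 3) R →ₐ[R] MvPolynomial (Fin 3) R :=
      aeval ![C Y * X 0, -(C x * X 0 + C Z * X 2), C Y * X 2]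
    have hρl : ρ (linForm ![x, Y, Z]) = 0 := by
      simp [ρ, linForm_vec3, algebraMap_eq]
      ring
    have hρs : ρ s = C Y * s := by
      simp [ρ, s, linForm_vec3, algebraMap_eq]
      ring
    have hρA : ρ A = 0 := by
      have := congrArg ρ hAW
      rw [map_mul, map_mul, hρl, hρs, zero_mul, mul_assoc] at this
      exact eq_zero_of_linForm_mul_eq_zero 2 (by simpa using H.minor_regular)
        (eq_zero_of_C_mul_eq_zero H.snd_regular this)
    have hmem : aeval (fun i => C Y * (X i : MvPolynomial (Fin 3) R)) A - ρ A ∈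
        Ideal.span {linForm ![x, Y, Z]} := by
      refine aeval_sub_aeval_mem (fun i => ?_) A
      rw [Ideal.mem_span_singleton]
      fin_cases i
      · simp
      · refine ⟨1, ?_⟩
        simp [linForm_vec3]
        ring
      · simp
    rw [hA.aeval_const_mul, aeval_X_left_apply, hρA, sub_zero] at hmem
    have hred : ∀ n, C Y ^ n * A ∈ Ideal.span {linForm ![x, Y, Z]} →
        A ∈ Ideal.span {linForm ![x, Y, Z]} := by
      intro n
      induction n with
      | zero => simp
      | succ n ih =>
        intro hn
        rw [pow_succ', mul_assoc, Ideal.mem_span_singleton] at hn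
        obtain ⟨V, hV⟩ := hn
        obtain ⟨V', rfl⟩ := exists_eq_C_mul_of_linForm_mul_eq (a := ![x, Y, Z]) (d := Y) (A := V)
          0 (by simpa using H.fst_regular_mod_snd) hV.symm
        refine ih (Ideal.mem_span_singleton.2 ⟨V', sub_eq_zero.1 ?_⟩)
        refine eq_zero_of_C_mul_eq_zero H.snd_regular ?_
        linear_combination hV
    exact Ideal.mem_span_singleton.1 (hred d hmem)
  have hx : ∀ u, x * u = 0 → u = 0 := (isWeaklyRegular_triple_iff.1 H.row).1
  obtain ⟨V, hV⟩ : ∃ V, D = linForm ![x, Y, Z] * V := by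
    change linForm ![x, Y, Z] ∣ D
    rw [← sum_homogeneousComponent D]
    refine Finset.dvd_sum fun d _ => hhom d _
      (homogeneousComponent d (-(C Y * B + C (q * Z ^ 2) * D)))
      (homogeneousComponent_isHomogeneous d D) ?_
    rw [← homogeneousComponent_mul_of_isHomogeneous (linForm_isHomogeneous _), hsD,
      homogeneousComponent_mul_of_isHomogeneous (linForm_isHomogeneous _)]
  refine ⟨V, hV, eq_neg_of_add_eq_zero_left (eq_zero_of_linForm_mul_eq_zero (a := ![x, Y, Z]) 0
    (by simpa using hx) ?_)⟩
  rw [hV] at h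
  linear_combination h

end RegularMinors

/-! ### The multiplier `δ` and the colon ideals of the cube. -/

section

variable {R : Type*} [CommRing R] {x Y Z p q : R}

theorem eval_signedMinors_linForm_fst :
    eval (signedMinors x Y Z p q) (linForm ![x, Y, Z]) = 0 := by
  simp [linForm_vec3, signedMinors]
  ring

theorem eval_signedMinors_linForm_snd :
    eval (signedMinors x Y Z p q) (linForm ![p * Y ^ 2, q * Z ^ 2, x ^ 2]) = 0 := by
  simp [linForm_vec3, signedMinors]
  ring

theorem eval_linForm {σ : Type*} [Fintype σ] (a f : σ → R) :
    eval f (linForm a) = ∑ j, a j * f j := by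
  simp [linForm]

theorem eval_mem_of_mem_map_C {σ : Type*} {J : Ideal R} {A : MvPolynomial σ R}
    (h : A ∈ J.map C) (v : σ → R) : eval v A ∈ J := by
  have h1 : J.map C ≤ J.comap (eval v : MvPolynomial σ R →+* R) := by
    rw [Ideal.map_le_iff_le_comap]
    intro r hr
    simpa using hr
  exact h1 h

theorem mem_map_C_span_triple {σ : Type*} {a b c : R} {A : MvPolynomial σ R}
    (h : ∃ D E F, A = C a * D + C b * E + C c * F) :
    A ∈ (Ideal.span {a, b, c}).map C := by
  obtain ⟨D, E, F, rfl⟩ := h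
  have (r : R) (hr : r ∈ ({a, b, c} : Set R)) (D : MvPolynomial σ R) :
      C r * D ∈ (Ideal.span {a, b, c}).map C :=
    Ideal.mul_mem_right _ _ (Ideal.mem_map_of_mem _ (Ideal.subset_span hr))
  exact add_mem (add_mem (this a (by simp) D) (this b (by simp) E)) (this c (by simp) F)

/-- `δ * (x, Y, Z)` is the cross product of the vector `f` of signed minors with
`(x * f₂, p * Y * f₀, q * Z * f₁)`. -/
structure IsMinorsMultiplier (x Y Z p q δ : R) : Prop where
  fst : x * δ = eval (signedMinors x Y Z p q) (C (q * Z) * X 1 ^ 2 - C (p * Y) * (X 0 * X 2))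
  snd : Y * δ = eval (signedMinors x Y Z p q) (C x * X 2 ^ 2 - C (q * Z) * (X 0 * X 1))
  thd : Z * δ = eval (signedMinors x Y Z p q) (C (p * Y) * X 0 ^ 2 - C x * (X 1 * X 2))

/-- The matrix of the linear map `f ↦ f ⨯₃ c`. -/
def crossMatrix (c : Fin 3 → R) : Matrix (Fin 3) (Fin 3) R :=
  !![0, c 2, -c 1; -c 2, 0, c 0; c 1, -c 0, 0]

end

namespace RegularMinors

variable {R : Type*} [CommRing R] {x Y Z p q : R}

theorem exists_isMinorsMultiplier (H : RegularMinors x Y Z p q) :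
    ∃ δ, IsMinorsMultiplier x Y Z p q δ := by
  obtain ⟨δ, h0, h1, h2⟩ := H.row.exists_eq_mul_of_cross_eq_zero
    (u := eval (signedMinors x Y Z p q) (C (q * Z) * X 1 ^ 2 - C (p * Y) * (X 0 * X 2)))
    (v := eval (signedMinors x Y Z p q) (C x * X 2 ^ 2 - C (q * Z) * (X 0 * X 1)))
    (w := eval (signedMinors x Y Z p q) (C (p * Y) * X 0 ^ 2 - C x * (X 1 * X 2)))
    (by simp [signedMinors]; ring) (by simp [signedMinors]; ring)
  exact ⟨δ, h0.symm, h1.symm, h2.symm⟩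

theorem linForm_snd_eq (x Y Z p q : R) : linForm ![p * Y ^ 2, q * Z ^ 2, x ^ 2] =
    C x * (C x * X 2) + C Y * (C (p * Y) * X 0) + C Z * (C (q * Z) * X 1) := by
  simp only [linForm_vec3, map_mul, map_pow]
  ring

theorem fst_regular (H : RegularMinors x Y Z p q) : ∀ u, x * u = 0 → u = 0 :=
  (isWeaklyRegular_triple_iff.1 H.row).1

/-- Every element multiplied by `x`, `Y`, `Z` into the cube of the ideal of minors lies in the sum
of this cube and the multiples by `δ` of elements of the ideal. -/
theorem exists_eq_eval_linForm_mul_add (H : RegularMinors x Y Z p q) {δ : R}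
    (hδ : IsMinorsMultiplier x Y Z p q δ) {g : R} {A₀ A₁ A₂ : MvPolynomial (Fin 3) R}
    (hA₀ : A₀.IsHomogeneous 3) (hA₁ : A₁.IsHomogeneous 3) (hA₂ : A₂.IsHomogeneous 3)
    (h₀ : eval (signedMinors x Y Z p q) A₀ = x * g)
    (h₁ : eval (signedMinors x Y Z p q) A₁ = Y * g)
    (h₂ : eval (signedMinors x Y Z p q) A₂ = Z * g) :
    ∃ D G : MvPolynomial (Fin 3) R, D.IsHomogeneous 1 ∧ G.IsHomogeneous 3 ∧
      g = eval (signedMinors x Y Z p q) D * δ + eval (signedMinors x Y Z p q) G := by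
  obtain ⟨B₀, D₀, e₀⟩ := H.exists_eq_of_eval_eq_zero (A := C Y * A₂ - C Z * A₁)
    ((hA₂.C_mul _).sub (hA₁.C_mul _)) (by simp [h₁, h₂]; ring)
  obtain ⟨B₁, D₁, e₁⟩ := H.exists_eq_of_eval_eq_zero (A := C Z * A₀ - C x * A₂)
    ((hA₀.C_mul _).sub (hA₂.C_mul _)) (by simp [h₀, h₂]; ring)
  obtain ⟨B₂, D₂, e₂⟩ := H.exists_eq_of_eval_eq_zero (A := C x * A₁ - C Y * A₀)
    ((hA₁.C_mul _).sub (hA₀.C_mul _)) (by simp [h₀, h₁]; ring)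
  obtain ⟨V, hD, hB⟩ := H.exists_eq_of_add_eq_zero (B := C x * B₀ + C Y * B₁ + C Z * B₂)
    (D := C x * D₀ + C Y * D₁ + C Z * D₂)
    (by linear_combination -C x * e₀ - C Y * e₁ - C Z * e₂)
  have hrow : IsWeaklyRegular (MvPolynomial (Fin 3) R) [C x, C Y, C Z] := H.row.map_C
  have hl2 := linForm_snd_eq x Y Z p q
  have hl1 : linForm ![x, Y, Z] = C x * X 0 + C Y * X 1 + C Z * X 2 := linForm_vec3 x Y Z
  set l₁ : MvPolynomial (Fin 3) R := linForm ![x, Y, Z] with hl₁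
  set l₂ : MvPolynomial (Fin 3) R := linForm ![p * Y ^ 2, q * Z ^ 2, x ^ 2] with hl₂
  -- The vectors `D - V X` and `B + V w` are orthogonal to the first row, hence cross products with
  -- it. Substituting them into `e₀`, `e₁`, `e₂` makes `A - V (X × w) - l₁ F - l₂ E` parallel to the
  -- row.
  obtain ⟨E₀, E₁, E₂, r₀, r₁, r₂⟩ := hrow.exists_eq_cross_of_dot_eq_zero (u := D₀ - X 0 * V)
    (v := D₁ - X 1 * V) (w := D₂ - X 2 * V) (by linear_combination hD + V * hl1)
  obtain ⟨F₀, F₁, F₂, s₀, s₁, s₂⟩ := hrow.exists_eq_cross_of_dot_eq_zero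
    (u := B₀ + C x * X 2 * V) (v := B₁ + C (p * Y) * X 0 * V) (w := B₂ + C (q * Z) * X 1 * V)
    (by linear_combination hB - V * hl2)
  obtain ⟨G, hG, -, -⟩ := hrow.exists_eq_mul_of_cross_eq_zero
    (u := A₀ - V * (C (q * Z) * X 1 ^ 2 - C (p * Y) * (X 0 * X 2)) - l₁ * F₀ - l₂ * E₀)
    (v := A₁ - V * (C x * X 2 ^ 2 - C (q * Z) * (X 0 * X 1)) - l₁ * F₁ - l₂ * E₁)
    (w := A₂ - V * (C (p * Y) * X 0 ^ 2 - C x * (X 1 * X 2)) - l₁ * F₂ - l₂ * E₂)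
    (by linear_combination e₁ + l₁ * s₁ + l₂ * r₁ + V * X 1 * hl2 - V * C (p * Y) * X 0 * hl1)
    (by linear_combination e₂ + l₁ * s₂ + l₂ * r₂ + V * X 2 * hl2 - V * C (q * Z) * X 1 * hl1)
  have hu : (C (q * Z) * X 1 ^ 2 - C (p * Y) * (X 0 * X 2) : MvPolynomial (Fin 3) R).IsHomogeneous 2 :=
    ((isHomogeneous_X_pow _ 2).C_mul _).sub
      (((isHomogeneous_X _ _).mul (isHomogeneous_X _ _)).C_mul _)
  have hcomp := congrArg (homogeneousComponent 3) (show A₀ =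
    (C (q * Z) * X 1 ^ 2 - C (p * Y) * (X 0 * X 2)) * V + l₁ * F₀ + l₂ * E₀ + C x * G by
      linear_combination hG)
  rw [map_add, map_add, map_add, homogeneousComponent_C_mul, homogeneousComponent_eq_self hA₀,
    homogeneousComponent_mul_of_isHomogeneous hu 1,
    homogeneousComponent_mul_of_isHomogeneous (linForm_isHomogeneous _) 2,
    homogeneousComponent_mul_of_isHomogeneous (linForm_isHomogeneous _) 2] at hcomp
  refine ⟨homogeneousComponent 1 V, homogeneousComponent 3 G,
    homogeneousComponent_isHomogeneous _ _, homogeneousComponent_isHomogeneous _ _, ?_⟩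
  have hev := congrArg (eval (signedMinors x Y Z p q)) hcomp
  rw [h₀, map_add, map_add, map_add, map_mul, ← hδ.fst, map_mul, eval_signedMinors_linForm_fst,
    map_mul, eval_signedMinors_linForm_snd, map_mul, eval_C] at hev
  refine sub_eq_zero.1 (H.fst_regular _ ?_)
  linear_combination hev

theorem mem_span_of_eval_linForm_mul_eq (H : RegularMinors x Y Z p q) {δ : R}
    (hδ : IsMinorsMultiplier x Y Z p q δ) {a : Fin 3 → R} {G : MvPolynomial (Fin 3) R}
    (hG : G.IsHomogeneous 3)
    (h : eval (signedMinors x Y Z p q) (linForm a) * δ = eval (signedMinors x Y Z p q) G)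
    (i : Fin 3) : a i ∈ Ideal.span {x, Y, Z} := by
  have ha := linForm_isHomogeneous a
  have hm (i j : Fin 3) : (X i * X j : MvPolynomial (Fin 3) R).IsHomogeneous 2 :=
    (isHomogeneous_X _ _).mul (isHomogeneous_X _ _)
  obtain ⟨B₁, D₁, e₁⟩ := H.exists_eq_of_eval_eq_zero
    (A := linForm a * (C x * X 2 ^ 2 - C (q * Z) * (X 0 * X 1)) - C Y * G)
    ((ha.mul (((isHomogeneous_X_pow _ 2).C_mul _).sub ((hm 0 1).C_mul _))).sub (hG.C_mul _))
    (by rw [map_sub, map_mul, ← hδ.snd, map_mul, eval_C]; linear_combination Y * h)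
  obtain ⟨B₂, D₂, e₂⟩ := H.exists_eq_of_eval_eq_zero
    (A := linForm a * (C (p * Y) * X 0 ^ 2 - C x * (X 1 * X 2)) - C Z * G)
    ((ha.mul (((isHomogeneous_X_pow _ 2).C_mul _).sub ((hm 1 2).C_mul _))).sub (hG.C_mul _))
    (by rw [map_sub, map_mul, ← hδ.thd, map_mul, eval_C]; linear_combination Z * h)
  have hl2 := linForm_snd_eq x Y Z p q
  have hl1 : linForm ![x, Y, Z] = C x * X 0 + C Y * X 1 + C Z * X 2 := linForm_vec3 x Y Z
  -- Combining `e₁` and `e₂` eliminates `G`. The identity `r × (X × w) = l₂ X - l₁ w` leaves a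
  -- relation between `l₁` and `l₂`; its coefficient at `l₂` is `-L X₀` modulo `x, Y, Z`, where `L =
  -- linForm a`.
  obtain ⟨V, hV, -⟩ := H.exists_eq_of_add_eq_zero
    (B := C Y * B₂ - C Z * B₁ + linForm a * (C x * X 2))
    (D := C Y * D₂ - C Z * D₁ - linForm a * X 0)
    (by linear_combination C Z * e₁ - C Y * e₂ - linForm a * X 0 * hl2 +
          linForm a * (C x * X 2) * hl1)
  have hmem : linForm a * X 0 ∈ (Ideal.span {x, Y, Z}).map C := by
    refine mem_map_C_span_triple ⟨-(X 0 * V), D₂ - X 1 * V, -D₁ - X 2 * V, ?_⟩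
    rw [hl1] at hV
    linear_combination -hV
  have hmem' : linForm a ∈ (Ideal.span {x, Y, Z}).map C := by
    rw [mem_map_C_iff] at hmem ⊢
    intro m
    have := hmem (m + Finsupp.single 0 1)
    rwa [coeff_mul_X] at this
  simpa [eval_linForm, Pi.single_apply] using eval_mem_of_mem_map_C hmem' (Pi.single i 1)

theorem alternating_of_eq_eval_linForm_mul_add (H : RegularMinors x Y Z p q) {δ : R}
    (hδ : IsMinorsMultiplier x Y Z p q δ) {g : R} {a : Fin 3 → Fin 3 → R}
    {G : Fin 3 → MvPolynomial (Fin 3) R} (hG : ∀ i, (G i).IsHomogeneous 3)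
    (h : ∀ i, ![x, Y, Z] i * g = eval (signedMinors x Y Z p q) (linForm (a i)) * δ +
      eval (signedMinors x Y Z p q) (G i)) :
    (∀ i, a i i ∈ Ideal.span {x, Y, Z}) ∧ ∀ i j, a i j + a j i ∈ Ideal.span {x, Y, Z} := by
  have ha (i) := linForm_isHomogeneous (a i)
  have h₀ : x * g = _ := h 0
  have h₁ : Y * g = _ := h 1
  have h₂ : Z * g = _ := h 2
  have hm (i j : Fin 3) : (X i * X j : MvPolynomial (Fin 3) R).IsHomogeneous 2 :=
    (isHomogeneous_X _ _).mul (isHomogeneous_X _ _)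
  have hu (b c : R) (i j k) : (C b * X i ^ 2 - C c * (X j * X k) :
      MvPolynomial (Fin 3) R).IsHomogeneous 2 :=
    ((isHomogeneous_X_pow _ 2).C_mul _).sub ((hm j k).C_mul _)
  obtain ⟨B₀, D₀, e₀⟩ := H.exists_eq_of_eval_eq_zero
    (A := linForm (a 1) * (C (p * Y) * X 0 ^ 2 - C x * (X 1 * X 2)) -
      linForm (a 2) * (C x * X 2 ^ 2 - C (q * Z) * (X 0 * X 1)) - (C Y * G 2 - C Z * G 1))
    ((((ha 1).mul (hu _ _ _ _ _)).sub ((ha 2).mul (hu _ _ _ _ _))).sub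
      (((hG 2).C_mul _).sub ((hG 1).C_mul _)))
    (by
      rw [map_sub, map_sub, map_mul, ← hδ.thd, map_mul, ← hδ.snd, map_sub, map_mul, eval_C,
        map_mul, eval_C]
      linear_combination Y * h₂ - Z * h₁)
  obtain ⟨B₁, D₁, e₁⟩ := H.exists_eq_of_eval_eq_zero
    (A := linForm (a 2) * (C (q * Z) * X 1 ^ 2 - C (p * Y) * (X 0 * X 2)) -
      linForm (a 0) * (C (p * Y) * X 0 ^ 2 - C x * (X 1 * X 2)) - (C Z * G 0 - C x * G 2))
    ((((ha 2).mul (hu _ _ _ _ _)).sub ((ha 0).mul (hu _ _ _ _ _))).sub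
      (((hG 0).C_mul _).sub ((hG 2).C_mul _)))
    (by
      rw [map_sub, map_sub, map_mul, ← hδ.fst, map_mul, ← hδ.thd, map_sub, map_mul, eval_C,
        map_mul, eval_C]
      linear_combination Z * h₀ - x * h₂)
  obtain ⟨B₂, D₂, e₂⟩ := H.exists_eq_of_eval_eq_zero
    (A := linForm (a 0) * (C x * X 2 ^ 2 - C (q * Z) * (X 0 * X 1)) -
      linForm (a 1) * (C (q * Z) * X 1 ^ 2 - C (p * Y) * (X 0 * X 2)) - (C x * G 1 - C Y * G 0))
    ((((ha 0).mul (hu _ _ _ _ _)).sub ((ha 1).mul (hu _ _ _ _ _))).sub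
      (((hG 1).C_mul _).sub ((hG 0).C_mul _)))
    (by
      rw [map_sub, map_sub, map_mul, ← hδ.snd, map_mul, ← hδ.fst, map_sub, map_mul, eval_C,
        map_mul, eval_C]
      linear_combination x * h₁ - Y * h₀)
  have hl2 := linForm_snd_eq x Y Z p q
  have hl1 : linForm ![x, Y, Z] = C x * X 0 + C Y * X 1 + C Z * X 2 := linForm_vec3 x Y Z
  -- The quadratic form of the matrix `a`: once its coefficients lie in `(x, Y, Z)`, `a` is
  -- alternating modulo that ideal. It appears as coefficient of `l₂` because `r · (L × (X × w)) = N
  -- l₁ - P l₂`.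
  let P : MvPolynomial (Fin 3) R := linForm (a 0) * X 0 + linForm (a 1) * X 1 + linForm (a 2) * X 2
  let N : MvPolynomial (Fin 3) R := linForm (a 0) * (C x * X 2) +
    linForm (a 1) * (C (p * Y) * X 0) + linForm (a 2) * (C (q * Z) * X 1)
  obtain ⟨V, hV, -⟩ := H.exists_eq_of_add_eq_zero
    (B := C x * B₀ + C Y * B₁ + C Z * B₂ - N) (D := C x * D₀ + C Y * D₁ + C Z * D₂ + P)
    (by linear_combination -C x * e₀ - C Y * e₁ - C Z * e₂ + P * hl2 - N * hl1)
  have hmem : P ∈ (Ideal.span {x, Y, Z}).map C := by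
    refine mem_map_C_span_triple ⟨X 0 * V - D₀, X 1 * V - D₁, X 2 * V - D₂, ?_⟩
    rw [hl1] at hV
    linear_combination hV
  have hev (v : Fin 3 → R) : ∑ i, (∑ j, a i j * v j) * v i ∈ Ideal.span {x, Y, Z} := by
    have := eval_mem_of_mem_map_C hmem v
    simp only [P, map_add, map_mul, eval_linForm, eval_X] at this
    rwa [Fin.sum_univ_three]
  have hdiag (i) : a i i ∈ Ideal.span {x, Y, Z} := by
    simpa [Pi.single_apply] using hev (Pi.single i 1)
  refine ⟨hdiag, fun i j => ?_⟩
  have hsum : a i i + a i j + (a j i + a j j) ∈ Ideal.span {x, Y, Z} := by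
    have := hev (Pi.single i 1 + Pi.single j 1)
    simpa [mul_add, Finset.sum_add_distrib, Pi.single_apply] using this
  have h3 := sub_mem (sub_mem hsum (hdiag i)) (hdiag j)
  convert h3 using 1
  ring

theorem exists_mul_sub_mem (H : RegularMinors x Y Z p q) {δ : R}
    (hδ : IsMinorsMultiplier x Y Z p q δ) {I : Ideal R}
    (hI : ∀ i, signedMinors x Y Z p q i ∈ I) (c : Fin 3 → R) :
    ∃ g, ∀ i, ![x, Y, Z] i * g -
      eval (signedMinors x Y Z p q) (linForm (crossMatrix c i)) * δ ∈ I ^ 3 := by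
  have hrel : x * signedMinors x Y Z p q 0 + Y * signedMinors x Y Z p q 1 +
      Z * signedMinors x Y Z p q 2 = 0 := by
    simp [signedMinors]
    ring
  obtain ⟨hx, hy, hz⟩ := hδ
  simp only [map_sub, map_mul, map_pow, eval_C, eval_X] at hx hy hz
  simp only [eval_linForm, Fin.sum_univ_three]
  generalize signedMinors x Y Z p q = f at *
  -- `W` has entries in `I ^ 2` and is chosen so that `r · W = (r · c) δ`. As `r · f = 0`, the
  -- vector `f × (δ c - W)` is then parallel to `r`.
  let W₀ := c 1 * f 2 ^ 2 - c 2 * (f 1 * f 2)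
  let W₁ := c 2 * p * f 0 ^ 2 - c 0 * p * (f 0 * f 2)
  let W₂ := c 0 * q * f 1 ^ 2 - c 1 * q * (f 0 * f 1)
  obtain ⟨g, h0, h1, h2⟩ := H.row.exists_eq_mul_of_cross_eq_zero
    (u := (f 1 * c 2 - f 2 * c 1) * δ - (f 1 * W₂ - f 2 * W₁))
    (v := (f 2 * c 0 - f 0 * c 2) * δ - (f 2 * W₀ - f 0 * W₂))
    (w := (f 0 * c 1 - f 1 * c 0) * δ - (f 0 * W₁ - f 1 * W₀))
    (by linear_combination (f 1 * c 2 - f 2 * c 1) * hz - (f 0 * c 1 - f 1 * c 0) * hx + W₁ * hrel)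
    (by linear_combination (f 2 * c 0 - f 0 * c 2) * hx - (f 1 * c 2 - f 2 * c 1) * hy + W₂ * hrel)
  have hmul (i j : Fin 3) : f i * f j ∈ I ^ 2 := by
    rw [pow_two]
    exact Ideal.mul_mem_mul (hI i) (hI j)
  have hW₀ : W₀ ∈ I ^ 2 := sub_mem (Ideal.mul_mem_left _ _ (pow_two (f 2) ▸ hmul 2 2))
    (Ideal.mul_mem_left _ _ (hmul _ _))
  have hW₁ : W₁ ∈ I ^ 2 := sub_mem (Ideal.mul_mem_left _ _ (pow_two (f 0) ▸ hmul 0 0))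
    (Ideal.mul_mem_left _ _ (hmul _ _))
  have hW₂ : W₂ ∈ I ^ 2 := sub_mem (Ideal.mul_mem_left _ _ (pow_two (f 1) ▸ hmul 1 1))
    (Ideal.mul_mem_left _ _ (hmul _ _))
  have hcube (i j : Fin 3) {v w : R} (hv : v ∈ I ^ 2) (hw : w ∈ I ^ 2) :
      -(f i * v - f j * w) ∈ I ^ 3 := by
    rw [pow_succ']
    exact neg_mem (sub_mem (Ideal.mul_mem_mul (hI i) hv) (Ideal.mul_mem_mul (hI j) hw))
  refine ⟨g, fun i => ?_⟩
  fin_cases i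
  · convert hcube 1 2 hW₂ hW₁ using 1
    simp [crossMatrix]
    linear_combination -h0
  · convert hcube 2 0 hW₀ hW₂ using 1
    simp [crossMatrix]
    linear_combination -h1
  · convert hcube 0 1 hW₁ hW₀ using 1
    simp [crossMatrix]
    linear_combination -h2

end RegularMinors

/-! ### Regularity conditions for powers of parameters. -/

theorem RegularMinors.of_isWeaklyRegular {R : Type*} [CommRing R] [IsNoetherianRing R]
    [IsLocalRing R] {x y z : R} (h : IsWeaklyRegular R [x, y, z])
    (hx : x ∈ IsLocalRing.maximalIdeal R) (hy : y ∈ IsLocalRing.maximalIdeal R)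
    (hz : z ∈ IsLocalRing.maximalIdeal R) {β γ β' γ' : ℕ} (hβ : 0 < β) (hγ : 0 < γ)
    (hβ' : 2 * β ≤ β') (hγ' : 2 * γ ≤ γ') :
    RegularMinors x (y ^ β) (z ^ γ) (y ^ (β' - 2 * β)) (z ^ (γ' - 2 * γ)) := by
  have perm {a b c a' b' c' : R} (h : IsWeaklyRegular R [a, b, c])
      (hp : List.Perm [a, b, c] [a', b', c']) (ha : a ∈ IsLocalRing.maximalIdeal R)
      (hb : b ∈ IsLocalRing.maximalIdeal R) (hc : c ∈ IsLocalRing.maximalIdeal R) :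
      IsWeaklyRegular R [a', b', c'] := by
    refine IsLocalRing.isWeaklyRegular_of_perm_of_subset_maximalIdeal h hp ?_
    simp only [List.mem_cons, List.not_mem_nil, or_false, forall_eq_or_imp, forall_eq]
    exact ⟨ha, hb, hc⟩
  have hY := Ideal.pow_mem_of_mem _ hy β hβ
  have hZ := Ideal.pow_mem_of_mem _ hz γ hγ
  have hi : z ^ (γ' - 2 * γ) * (z ^ γ) ^ 3 = z ^ (γ' + γ) := by
    rw [← pow_mul, ← pow_add]
    congr 1
    omega
  have hj : y ^ (β' - 2 * β) * (y ^ β) ^ 3 = y ^ (β' + β) := by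
    rw [← pow_mul, ← pow_add]
    congr 1
    omega
  have hzi : z ^ (γ' + γ) ∈ IsLocalRing.maximalIdeal R := Ideal.pow_mem_of_mem _ hz _ (by omega)
  have hrow := h.pow_triple hx hy hz hβ hγ
  obtain ⟨s1, s2, -⟩ := isWeaklyRegular_triple_iff.1
    (perm hrow (List.Perm.swap _ _ _) hx hY hZ : IsWeaklyRegular R [y ^ β, x, z ^ γ])
  have hYZ : IsWeaklyRegular R [y ^ β, z ^ (γ' + γ), x] :=
    perm (h.pow_triple hx hy hz hβ (n := γ' + γ) (by omega))
      ((List.perm_append_comm : List.Perm ([x] ++ [y ^ β, z ^ (γ' + γ)]) _)) hx hY hzi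
  obtain ⟨-, t2, -⟩ := isWeaklyRegular_triple_iff.1 hYZ
  have hxzy : IsWeaklyRegular R [x, z ^ (γ' + γ), y ^ (β' + β)] :=
    (perm h ((List.Perm.swap _ _ _).cons _) hx hy hz).pow_triple hx hz hy (by omega) (by omega)
  obtain ⟨u1, u2, u3⟩ := isWeaklyRegular_triple_iff.1 hxzy
  -- Modulo `x` these two minors are, up to sign, powers of `z` and `y`.
  have hminors : IsWeaklyRegular R [x, y ^ β * x ^ 2 - z ^ (γ' - 2 * γ) * (z ^ γ) ^ 3,
      z ^ (γ' - 2 * γ) * x * (z ^ γ) ^ 2 - y ^ (β' - 2 * β) * (y ^ β) ^ 3] := by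
    rw [hi, hj]
    refine isWeaklyRegular_triple_iff.2 ⟨u1, fun u v huv => ?_, fun u v w huv => ?_⟩
    · exact u2 u (y ^ β * x * u - v) (by linear_combination -huv)
    · obtain ⟨s, t, rfl⟩ := u3 u
        (z ^ (γ' - 2 * γ) * (z ^ γ) ^ 2 * u - v - y ^ β * x * w) w (by linear_combination -huv)
      exact ⟨s + y ^ β * x * t, -t, by ring⟩
  have hf : y ^ β * x ^ 2 - z ^ (γ' - 2 * γ) * (z ^ γ) ^ 3 ∈ IsLocalRing.maximalIdeal R := by
    rw [hi]
    exact sub_mem (Ideal.mul_mem_right _ _ hY) hzi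
  have hg : z ^ (γ' - 2 * γ) * x * (z ^ γ) ^ 2 - y ^ (β' - 2 * β) * (y ^ β) ^ 3 ∈
      IsLocalRing.maximalIdeal R := by
    rw [hj]
    exact sub_mem (Ideal.mul_mem_right _ _ (Ideal.mul_mem_left _ _ hx))
      (Ideal.pow_mem_of_mem _ hy _ (by omega))
  obtain ⟨v1, v2, v3⟩ := isWeaklyRegular_triple_iff.1
    (perm hminors (List.perm_append_comm : List.Perm ([_] ++ [_, _]) _) hx hf hg)
  refine ⟨hrow, s1, s2, v1, fun u v huv => ?_, v2, v3⟩
  obtain ⟨v', rfl⟩ := t2 v (x ^ 2 * v - u) (by rw [← hi]; linear_combination huv)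
  exact ⟨v', sub_eq_zero.1 (s1 _ (by linear_combination huv))⟩

/-! ### Assembly of the isomorphism. -/

theorem maximalMinorsIdeal_two_three {R : Type*} [CommRing R] (M : Matrix (Fin 2) (Fin 3) R) :
    maximalMinorsIdeal M = Ideal.span (Set.range ![M 0 1 * M 1 2 - M 0 2 * M 1 1,
      M 0 2 * M 1 0 - M 0 0 * M 1 2, M 0 0 * M 1 1 - M 0 1 * M 1 0]) := by
  set g : Fin 3 → R := ![M 0 1 * M 1 2 - M 0 2 * M 1 1,
      M 0 2 * M 1 0 - M 0 0 * M 1 2, M 0 0 * M 1 1 - M 0 1 * M 1 0] with hg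
  have hmem (i) : g i ∈ Ideal.span (Set.range g) := Ideal.subset_span ⟨i, rfl⟩
  apply le_antisymm
  · rw [maximalMinorsIdeal, Ideal.span_le]
    rintro _ ⟨e, rfl⟩
    have hlt : e 0 < e 1 := e.strictMono Fin.zero_lt_one
    simp only [Matrix.det_fin_two, Matrix.submatrix_apply, id, SetLike.mem_coe]
    generalize e 0 = i at *
    generalize e 1 = j at *
    have hcases : (i = 0 ∧ j = 1) ∨ (i = 0 ∧ j = 2) ∨ (i = 1 ∧ j = 2) := by omega
    obtain ⟨rfl, rfl⟩ | ⟨rfl, rfl⟩ | ⟨rfl, rfl⟩ := hcases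
    · exact hmem 2
    · convert neg_mem (hmem 1) using 1
      simp [hg]
    · exact hmem 0
  · rw [Ideal.span_le]
    have hdet (i : Fin 3) : (M.submatrix id (Fin.succAboveOrderEmb i)).det ∈
        maximalMinorsIdeal M := Ideal.subset_span ⟨_, rfl⟩
    rintro _ ⟨i, rfl⟩
    fin_cases i
    · simpa [Matrix.det_fin_two, hg] using hdet 0
    · convert neg_mem (hdet 1) using 1
      simp [Matrix.det_fin_two, hg, Fin.succAbove]
    · simpa [Matrix.det_fin_two, hg, Fin.succAbove] using hdet 2

theorem Ideal.mem_colon_span_triple {R : Type*} [CommRing R] {J : Ideal R} {a b c g : R} :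
    g ∈ J.colon ((Ideal.span {a, b, c} : Ideal R) : Set R) ↔ ∀ i, ![a, b, c] i * g ∈ J := by
  rw [Ideal.colon_span, Submodule.mem_colon]
  simp [Fin.forall_fin_succ, mul_comm g]

theorem Ideal.colon_sq {R : Type*} [CommRing R] (J Q : Ideal R) :
    J.colon ((Q ^ 2 : Ideal R) : Set R) = (J.colon (Q : Set R)).colon (Q : Set R) := by
  ext g
  simp only [Submodule.mem_colon, smul_eq_mul, SetLike.mem_coe]
  constructor
  · intro h s hs t ht
    rw [mul_assoc]
    exact h _ (pow_two Q ▸ Ideal.mul_mem_mul hs ht)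
  · intro h s hs
    rw [pow_two] at hs
    induction hs using Submodule.mul_induction_on' with
    | mem_mul_mem a ha b hb => rw [← mul_assoc]; exact h a ha b hb
    | add a _ b _ hha hhb => rw [mul_add]; exact add_mem hha hhb

/-- Two surjective linear maps with the same kernel have isomorphic codomains. -/
noncomputable def LinearEquiv.ofSurjectiveOfKerEq {R M A B : Type*} [CommRing R] [AddCommGroup M]
    [AddCommGroup A] [AddCommGroup B] [Module R M] [Module R A] [Module R B] {φ : M →ₗ[R] A}
    {ψ : M →ₗ[R] B} (hφ : Function.Surjective φ) (hψ : Function.Surjective ψ)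
    (h : LinearMap.ker φ = LinearMap.ker ψ) : A ≃ₗ[R] B :=
  (φ.quotKerEquivOfSurjective hφ).symm ≪≫ₗ Submodule.quotEquivOfEq _ _ h ≪≫ₗ
    ψ.quotKerEquivOfSurjective hψ

theorem RegularMinors.nonempty_linearEquiv {R : Type*} [CommRing R] {x Y Z p q : R}
    (H : RegularMinors x Y Z p q) {I Q : Ideal R}
    (hI : I = Ideal.span (Set.range (signedMinors x Y Z p q))) (hQ : Q = Ideal.span {x, Y, Z}) :
    Nonempty
      ((((I ^ 3).colon ((Q ^ 2 : Ideal R) : Set R) : Ideal R) ⧸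
          ((I ^ 3).colon (Q : Set R)).submoduleOf ((I ^ 3).colon ((Q ^ 2 : Ideal R) : Set R)))
        ≃ₗ[R] (Fin 3 → R ⧸ Q)) := by
  obtain ⟨δ, hδ⟩ := H.exists_isMinorsMultiplier
  have hfI (i) : signedMinors x Y Z p q i ∈ I := hI ▸ Ideal.subset_span ⟨i, rfl⟩
  have hcube (A : MvPolynomial (Fin 3) R) (hA : A.IsHomogeneous 3) :
      eval (signedMinors x Y Z p q) A ∈ I ^ 3 := by
    rw [hI, Ideal.mem_span_pow_iff_exists_isHomogeneous]
    exact ⟨A, hA, rfl⟩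
  have hcube' {r : R} (hr : r ∈ I ^ 3) : ∃ A : MvPolynomial (Fin 3) R, A.IsHomogeneous 3 ∧
      eval (signedMinors x Y Z p q) A = r := by
    rwa [hI, Ideal.mem_span_pow_iff_exists_isHomogeneous] at hr
  have hcolon (g : R) : g ∈ (I ^ 3).colon (Q : Set R) ↔ ∀ i, ![x, Y, Z] i * g ∈ I ^ 3 :=
    hQ ▸ Ideal.mem_colon_span_triple
  have hcolon2 (g : R) : g ∈ (I ^ 3).colon ((Q ^ 2 : Ideal R) : Set R) ↔
      ∀ i, ![x, Y, Z] i * g ∈ (I ^ 3).colon (Q : Set R) :=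
    by rw [Ideal.colon_sq, hQ, Ideal.mem_colon_span_triple]
  have hδmem (i) : ![x, Y, Z] i * δ ∈ I ^ 2 := by
    rw [hI, Ideal.mem_span_pow_iff_exists_isHomogeneous]
    have hX (i) := isHomogeneous_X R (σ := Fin 3) i
    fin_cases i
    · exact ⟨_, (((hX 1).pow 2).C_mul _).sub (((hX 0).mul (hX 2)).C_mul _), hδ.fst.symm⟩
    · exact ⟨_, (((hX 2).pow 2).C_mul _).sub (((hX 0).mul (hX 1)).C_mul _), hδ.snd.symm⟩
    · exact ⟨_, (((hX 0).pow 2).C_mul _).sub (((hX 1).mul (hX 2)).C_mul _), hδ.thd.symm⟩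
  have hδQ {a r : R} (ha : a ∈ Q) (hr : r ∈ I) : a * (r * δ) ∈ I ^ 3 := by
    have h1 : r * δ ∈ (I ^ 3).colon (Q : Set R) := by
      rw [hcolon]
      intro i
      rw [mul_left_comm, pow_succ']
      exact Ideal.mul_mem_mul hr (hδmem i)
    rw [mul_comm]
    exact Submodule.mem_colon.1 h1 a ha
  have hgen {g : R} (hg : g ∈ (I ^ 3).colon (Q : Set R)) :
      ∃ (a : Fin 3 → R) (G : MvPolynomial (Fin 3) R), G.IsHomogeneous 3 ∧
        g = eval (signedMinors x Y Z p q) (linForm a) * δ + eval (signedMinors x Y Z p q) G := by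
    rw [hcolon] at hg
    obtain ⟨A₀, hA₀, h₀⟩ := hcube' (hg 0)
    obtain ⟨A₁, hA₁, h₁⟩ := hcube' (hg 1)
    obtain ⟨A₂, hA₂, h₂⟩ := hcube' (hg 2)
    obtain ⟨D, G, hD, hG, e⟩ := H.exists_eq_eval_linForm_mul_add hδ hA₀ hA₁ hA₂ h₀ h₁ h₂
    have hmem : eval (signedMinors x Y Z p q) D ∈ I := by
      rw [hI, Ideal.mem_span_iff_exists_isHomogeneous]
      exact ⟨D, hD, rfl⟩
    rw [hI, Ideal.mem_span_range_iff_exists_fun] at hmem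
    obtain ⟨a, ha⟩ := hmem
    exact ⟨a, G, hG, by rw [eval_linForm, ha, e]⟩
  have hmemI (a : Fin 3 → R) : eval (signedMinors x Y Z p q) (linForm a) ∈ I := by
    rw [eval_linForm]
    exact sum_mem fun j _ => Ideal.mul_mem_left _ _ (hfI j)
  have hlinQ {a : Fin 3 → R} (ha : ∀ j, a j ∈ Q) :
      eval (signedMinors x Y Z p q) (linForm a) * δ ∈ I ^ 3 := by
    rw [eval_linForm, Finset.sum_mul]
    exact sum_mem fun j _ => mul_assoc (a j) _ _ ▸ hδQ (ha j) (hfI j)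
  choose g hg using H.exists_mul_sub_mem hδ hfI
  -- The chosen `g` need not be linear in `c`; only its values on unit vectors are kept and extended
  -- linearly.
  let h : (Fin 3 → R) →ₗ[R] R := Fintype.linearCombination R fun k => g (Pi.single k 1)
  have hh (c : Fin 3 → R) (i) : ![x, Y, Z] i * h c -
      eval (signedMinors x Y Z p q) (linForm (crossMatrix c i)) * δ ∈ I ^ 3 := by
    have : ![x, Y, Z] i * h c - eval (signedMinors x Y Z p q) (linForm (crossMatrix c i)) * δ =
        ∑ k, c k * (![x, Y, Z] i * g (Pi.single k 1) -
          eval (signedMinors x Y Z p q) (linForm (crossMatrix (Pi.single k 1) i)) * δ) := by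
      simp only [h, Fintype.linearCombination_apply, eval_linForm, Fin.sum_univ_three,
        smul_eq_mul]
      fin_cases i <;> simp [crossMatrix] <;> ring
    rw [this]
    exact sum_mem fun k _ => Ideal.mul_mem_left _ _ (hg _ i)
  have hmem (c : Fin 3 → R) : h c ∈ (I ^ 3).colon ((Q ^ 2 : Ideal R) : Set R) := by
    refine (hcolon2 _).2 fun i => ?_
    rw [← sub_add_cancel (![x, Y, Z] i * h c)]
    refine add_mem (Ideal.le_colon (hh c i)) (Submodule.mem_colon.2 fun s hs => ?_)
    rw [smul_eq_mul, mul_comm]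
    exact hδQ hs (hmemI _)
  have hker (c : Fin 3 → R) : h c ∈ (I ^ 3).colon (Q : Set R) ↔ ∀ k, c k ∈ Q := by
    rw [hcolon]
    constructor
    · intro hc
      have hentry (i j) : crossMatrix c i j ∈ Q := by
        obtain ⟨G, hG, hGe⟩ := hcube' (sub_mem (hc i) (hh c i))
        rw [sub_sub_cancel] at hGe
        exact hQ ▸ H.mem_span_of_eval_linForm_mul_eq hδ hG hGe.symm j
      intro k
      fin_cases k
      exacts [hentry 1 2, hentry 2 0, hentry 0 1]
    · intro hc i
      rw [← sub_add_cancel (![x, Y, Z] i * h c)]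
      refine add_mem (hh c i) (hlinQ fun j => ?_)
      have hneg (k) : -c k ∈ Q := neg_mem (hc k)
      fin_cases i <;> fin_cases j <;> simp [crossMatrix, hc]
  have hsurj {r : R} (hr : r ∈ (I ^ 3).colon ((Q ^ 2 : Ideal R) : Set R)) :
      ∃ c, h c - r ∈ (I ^ 3).colon (Q : Set R) := by
    choose a G hG e using fun i => hgen ((hcolon2 r).1 hr i)
    obtain ⟨hdiag, hanti⟩ := H.alternating_of_eq_eval_linForm_mul_add hδ hG e
    rw [← hQ] at hdiag hanti
    -- These are the positions at which `crossMatrix c` has entries `c 0`, `c 1`, `c 2`.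
    refine ⟨![a 1 2, a 2 0, a 0 1], (hcolon _).2 fun i => ?_⟩
    have hQij (j) : (crossMatrix ![a 1 2, a 2 0, a 0 1] i - a i) j ∈ Q := by
      have hd (i) : -a i i ∈ Q := neg_mem (hdiag i)
      have ha (i j) : -a i j - a j i ∈ Q := by
        convert neg_mem (hanti i j) using 1
        ring
      fin_cases i <;> fin_cases j <;> simp [crossMatrix, hdiag]
      exacts [ha 2 0, ha 0 1, ha 1 2]
    have heq : ![x, Y, Z] i * (h ![a 1 2, a 2 0, a 0 1] - r) =
        (![x, Y, Z] i * h ![a 1 2, a 2 0, a 0 1] - eval (signedMinors x Y Z p q)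
          (linForm (crossMatrix ![a 1 2, a 2 0, a 0 1] i)) * δ) +
        eval (signedMinors x Y Z p q) (linForm (crossMatrix ![a 1 2, a 2 0, a 0 1] i - a i)) * δ -
        eval (signedMinors x Y Z p q) (G i) := by
      rw [mul_sub, e i]
      simp only [eval_linForm, Pi.sub_apply, sub_mul, Finset.sum_sub_distrib]
      ring
    rw [heq]
    exact sub_mem (add_mem (hh _ i) (hlinQ hQij)) (hcube _ (hG i))
  let φ := (Submodule.mkQ (((I ^ 3).colon (Q : Set R)).submoduleOf
    ((I ^ 3).colon ((Q ^ 2 : Ideal R) : Set R)))).comp (h.codRestrict _ hmem)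
  let ψ : (Fin 3 → R) →ₗ[R] (Fin 3 → R ⧸ Q) := LinearMap.pi fun k => Q.mkQ.comp (LinearMap.proj k)
  refine ⟨LinearEquiv.ofSurjectiveOfKerEq (φ := φ) (ψ := ψ) ?_ ?_ ?_⟩
  · intro w
    obtain ⟨⟨r, hr⟩, rfl⟩ := Submodule.mkQ_surjective _ w
    obtain ⟨c, hc⟩ := hsurj hr
    exact ⟨c, (Submodule.Quotient.eq _).2 hc⟩
  · intro w
    choose c hc using fun k => Submodule.mkQ_surjective Q (w k)
    exact ⟨c, funext hc⟩
  · ext c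
    have h1 : c ∈ LinearMap.ker φ ↔ h c ∈ (I ^ 3).colon (Q : Set R) :=
      LinearMap.mem_ker.trans (Submodule.Quotient.mk_eq_zero _)
    rw [h1, hker, LinearMap.mem_ker, funext_iff]
    exact forall_congr' fun k => (Submodule.Quotient.mk_eq_zero Q).symm

theorem theorem4p8 {R : Type*} [CommRing R] [IsCohenMacaulayLocalRing R]
    (hdim : ringKrullDim R = 3)
    (x y z : R) (hxyz : IsSystemOfParameters ![x, y, z])
    (α β γ α' β' γ' : ℕ)
    (hα_pos : 0 < α) (hβ_pos : 0 < β) (hγ_pos : 0 < γ)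
    (hα'_pos : 0 < α') (hβ'_pos : 0 < β') (hγ'_pos : 0 < γ')
    (I Q : Ideal R)
    (hI : I = maximalMinorsIdeal !![x ^ α, y ^ β, z ^ γ; y ^ β', z ^ γ', x ^ α'])
    (hQ : Q = Ideal.span {x ^ min α α', y ^ min β β', z ^ min γ γ'})
    (hα : α = 1) (hα' : α' = 2) (hβ : 2 * β ≤ β') (hγ : 2 * γ ≤ γ') :
    (I ^ 3).colon (Q : Set R) ≤ (I ^ 3).colon ((Q ^ 2 : Ideal R) : Set R) ∧
    Nonempty
      ((((I ^ 3).colon ((Q ^ 2 : Ideal R) : Set R) : Ideal R) ⧸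
          ((I ^ 3).colon (Q : Set R)).submoduleOf ((I ^ 3).colon ((Q ^ 2 : Ideal R) : Set R)))
        ≃ₗ[R] (Fin 3 → R ⧸ Q)) := by
  refine ⟨Submodule.colon_mono le_rfl (Ideal.pow_le_self two_ne_zero), ?_⟩
  subst hα hα'
  have hmem (i) : ![x, y, z] i ∈ IsLocalRing.maximalIdeal R := by
    rw [← hxyz.2]
    exact Ideal.le_radical (Ideal.subset_span ⟨i, rfl⟩)
  have hreg : IsWeaklyRegular R [x, y, z] := by simpa using hxyz.isWeaklyRegular
  have H := RegularMinors.of_isWeaklyRegular hreg (hmem 0) (hmem 1) (hmem 2) hβ_pos hγ_pos hβ hγ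
  refine H.nonempty_linearEquiv ?_ ?_
  · have hβ' : y ^ β' = y ^ (β' - 2 * β) * (y ^ β) ^ 2 := by
      rw [← pow_mul, ← pow_add]
      congr 1
      omega
    have hγ' : z ^ γ' = z ^ (γ' - 2 * γ) * (z ^ γ) ^ 2 := by
      rw [← pow_mul, ← pow_add]
      congr 1
      omega
    rw [hI, maximalMinorsIdeal_two_three]
    congr 2
    funext i
    fin_cases i <;> simp [signedMinors, hβ', hγ'] <;> ring
  · rw [hQ, min_eq_left one_le_two, min_eq_left (by omega), min_eq_left (by omega), pow_one]

end
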